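/- Let $a,b,n\ge 1$ be integers, let $\sigma^2>0$ and $\sigma^2_{\alpha\beta}\ge 0$, and consider the balanced two-way model \[ y_{ijk}=\mu+\alpha_i+\beta_j+(\alpha\beta)_{ij}+e_{ijk},\qquad i=1,\dots,a,\ j=1,\dots,b,\ k=1,\dots,n, \] with independent errors $e_{ijk}\sim N(0,\sigma^2)$. Let \[ SS_{AB}=\sum_{i=1}^a\sum_{j=1}^b\sum_{k=1}^n\bigl(\bar y_{ij.}-\bar y_{i..}-\bar y_{.j.}+\bar y_{...}\bigr)^2 ,\qquad \gamma_{AB}=n\sum_{i=1}^a\sum_{j=1}^b\bigl[(\alpha\beta)_{ij}-\overline{(\alpha\beta)}_{i.}-\overline{(\alpha\beta)}_{.j}+\overline{(\alpha\beta)}_{..}\bigr]^2 , \] where a bar and a dot denote the arithmetic mean over the dotted index. Write $\chi^2(p,\lambda)$ for the noncentral chi-square distribution with $p$ degrees of freedom and noncentrality parameter $\lambda$, that is, the law of $(Z_1+\sqrt\lambda)^2+Z_2^2+\dots+Z_p^2$ with $Z_1,\dots,Z_p$ independent standard normal; write $\chi^2(p)=\chi^2(p,0)$ (the point mass at $0$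 if $p=0$), and $c\,\chi^2$ for the law of $c$ times such a variable. (i) If all effects $\alpha_i$, $\beta_j$, $(\alpha\beta)_{ij}$ are fixed (real constants), then $SS_{AB}\sim\sigma^2\chi^2\bigl((a-1)(b-1),\ \gamma_{AB}/\sigma^2\bigr)$. Suppose now that the interaction effects are random, $(\alpha\beta)_{ij}\sim N(0,\sigma^2_{\alpha\beta})$, and that all the $(\alpha\beta)_{ij}$ and $e_{ijk}$ are mutually independent; the main effects $\alpha_i$ and $\beta_j$ may be fixed or random. Then (ii) $\gamma_{AB}\sim n\sigma^2_{\alpha\beta}\,\chi^2\bigl((a-1)(b-1)\bigr)$, and (iii) $SS_{AB}\sim(\sigma^2+n\sigma^2_{\alpha\beta})\,\chi^2\bigl((a-1)(b-1)\bigr)$. -/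

import Mathlib

open MeasureTheory ProbabilityTheory
open scoped NNReal

noncomputable section

namespace TwoWay

/-- The (central) chi-square distribution `χ²(p)`: the law of `Z₁² + ⋯ + Z_p²` for independent
standard normal `Z₁, …, Z_p` (for `p = 0`, the point mass at `0`). -/
def chiSq (p : ℕ) : Measure ℝ :=
  (Measure.pi fun _ : Fin p => gaussianReal 0 1).map fun z => ∑ i, z i ^ 2

/-- The noncentral chi-square distribution `χ²(p, lam)` with noncentrality parameter `lam ≥ 0`:
the law of `(Z₁ + √lam)² + Z₂² + ⋯ + Z_p²` for independent standard normal `Z₁, …, Z_p`. -/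
def noncentralChiSq (p : ℕ) (lam : ℝ) : Measure ℝ :=
  (Measure.pi fun _ : Fin p => gaussianReal 0 1).map fun z =>
    ∑ i : Fin p, (z i + if (i : ℕ) = 0 then √lam else 0) ^ 2

/-- The law of `c * X` when `X` has law `ν`. -/
def scaleLaw (c : ℝ) (ν : Measure ℝ) : Measure ℝ := ν.map fun x => c * x

variable {a b n : ℕ}

/-- The row mean `x̄_{i.}` of a two-way table. -/
def rowMean (x : Fin a → Fin b → ℝ) (i : Fin a) : ℝ := (∑ j, x i j) / b

/-- The column mean `x̄_{.j}` of a two-way table. -/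
def colMean (x : Fin a → Fin b → ℝ) (j : Fin b) : ℝ := (∑ i, x i j) / a

/-- The overall mean `x̄_{..}` of a two-way table. -/
def grandMean (x : Fin a → Fin b → ℝ) : ℝ := (∑ i, ∑ j, x i j) / ((a : ℝ) * b)

/-- `γ_AB = n ∑ᵢ ∑ⱼ (x_{ij} - x̄_{i.} - x̄_{.j} + x̄_{..})²` for a table `x` of interaction effects
and `n` replicates per cell. -/
def gammaAB (n : ℕ) (x : Fin a → Fin b → ℝ) : ℝ :=
  n * ∑ i, ∑ j, (x i j - rowMean x i - colMean x j + grandMean x) ^ 2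

/-- The interaction sum of squares
`SS_AB = ∑ᵢ ∑ⱼ ∑ₖ (ȳ_{ij.} - ȳ_{i..} - ȳ_{.j.} + ȳ_{...})²` of the observations `y_{ijk}`. -/
def ssAB (y : Fin a → Fin b → Fin n → ℝ) : ℝ :=
  ∑ i, ∑ j, ∑ _k : Fin n,
    ((∑ k', y i j k') / n
      - (∑ j', ∑ k', y i j' k') / ((b : ℝ) * n)
      - (∑ i', ∑ k', y i' j k') / ((a : ℝ) * n)
      + (∑ i', ∑ j', ∑ k', y i' j' k') / ((a : ℝ) * b * n)) ^ 2

/-- The observations `y_{ijk} = μ + α_i + β_j + (αβ)_{ij} + e_{ijk}` of the two-way model. -/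
def response (mu : ℝ) (α : Fin a → ℝ) (β : Fin b → ℝ) (ab : Fin a → Fin b → ℝ)
    (e : Fin a → Fin b → Fin n → ℝ) (i : Fin a) (j : Fin b) (k : Fin n) : ℝ :=
  mu + α i + β j + ab i j + e i j k

end TwoWay

end

/-! Taking interaction residuals is a linear map `T` on `a × b` tables that is idempotent and
self-adjoint, hence an orthogonal projection, and its trace gives the rank `(a - 1) * (b - 1)`. It
kills additive tables, so `SS_AB` is `n‖T x‖²` for the table `x` of interaction effects plus cell
means of errors (`ssAB_response`). If `x = m + W` with `W` a table of independent `N(0, v)` entries,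
the coordinates of `T x` in an orthonormal basis of the range are independent normals of variance
`v`. Choosing the first basis vector along `T m` puts the whole noncentrality in one coordinate
(`hasLaw_gammaAB`). The three claims are the cases `v = σ²/n` with `m` the fixed effects, and `v =
σ²_αβ` and `v = σ²_αβ + σ²/n` with `m = 0`. -/

namespace TwoWay

/-! ### Interaction residuals as an orthogonal projection -/

section Residual

variable {a b n : ℕ}

/-- The interaction residuals `x_{ij} - x̄_{i.} - x̄_{.j} + x̄_{..}` of a two-way table. -/
noncomputable def residual (x : Fin a → Fin b → ℝ) (i : Fin a) (j : Fin b) : ℝ :=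
  x i j - rowMean x i - colMean x j + grandMean x

lemma residual_add (x y : Fin a → Fin b → ℝ) (i : Fin a) (j : Fin b) :
    residual (fun i j => x i j + y i j) i j = residual x i j + residual y i j := by
  simp only [residual, rowMean, colMean, grandMean, Finset.sum_add_distrib]
  ring

lemma residual_const_mul (c : ℝ) (x : Fin a → Fin b → ℝ) (i : Fin a) (j : Fin b) :
    residual (fun i j => c * x i j) i j = c * residual x i j := by
  simp only [residual, rowMean, colMean, grandMean, ← Finset.mul_sum]
  ring

/-- An additive table has no interaction residuals. -/
lemma residual_additive (ha : a ≠ 0) (hb : b ≠ 0) (u : Fin a → ℝ) (w : Fin b → ℝ)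
    (i : Fin a) (j : Fin b) : residual (fun i j => u i + w j) i j = 0 := by
  have ha' : (a : ℝ) ≠ 0 := by exact_mod_cast ha
  have hb' : (b : ℝ) ≠ 0 := by exact_mod_cast hb
  simp only [residual, rowMean, colMean, grandMean, Finset.sum_add_distrib, Finset.sum_const,
    Finset.card_univ, Fintype.card_fin, nsmul_eq_mul, ← Finset.mul_sum]
  field_simp
  ring

/-- What `residual` subtracts from a table is itself an additive table, which has no residuals. -/
lemma residual_idem (ha : a ≠ 0) (hb : b ≠ 0) (x : Fin a → Fin b → ℝ) (i : Fin a) (j : Fin b) :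
    residual (residual x) i j = residual x i j := by
  have h := residual_add (residual x)
    (fun i j => (rowMean x i - grandMean x) + colMean x j) i j
  rw [residual_additive ha hb (fun i => rowMean x i - grandMean x) (colMean x), add_zero] at h
  rw [← h]
  congr 1
  ext i j
  simp only [residual]
  ring

/-- The right-hand side is symmetric in `x` and `y`; this is what makes `residual` self-adjoint. -/
lemma sum_residual_mul (x y : Fin a → Fin b → ℝ) :
    ∑ i, ∑ j, residual x i j * y i j = ∑ i, ∑ j, x i j * y i j
      - (∑ i, (∑ j, x i j) * (∑ j, y i j)) / b - (∑ j, (∑ i, x i j) * (∑ i, y i j)) / a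
      + (∑ i, ∑ j, x i j) * (∑ i, ∑ j, y i j) / (a * b) := by
  have hc : ∑ i, ∑ j, colMean x j * y i j = (∑ j, (∑ i, x i j) * (∑ i, y i j)) / a := by
    rw [Finset.sum_comm, Finset.sum_div]
    refine Finset.sum_congr rfl fun j _ => ?_
    rw [← Finset.mul_sum, colMean]
    ring
  have hr : ∑ i, ∑ j, rowMean x i * y i j = (∑ i, (∑ j, x i j) * (∑ j, y i j)) / b := by
    rw [Finset.sum_div]
    refine Finset.sum_congr rfl fun i _ => ?_
    rw [← Finset.mul_sum, rowMean]
    ring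
  simp only [residual, add_mul, sub_mul, Finset.sum_add_distrib, Finset.sum_sub_distrib, hc, hr]
  simp only [← Finset.mul_sum, grandMean]
  ring

lemma sum_residual_mul_comm (x y : Fin a → Fin b → ℝ) :
    ∑ i, ∑ j, residual x i j * y i j = ∑ i, ∑ j, x i j * residual y i j := by
  have h : ∑ i, ∑ j, x i j * residual y i j = ∑ i, ∑ j, residual y i j * x i j :=
    Finset.sum_congr rfl fun i _ => Finset.sum_congr rfl fun j _ => mul_comm _ _
  rw [h, sum_residual_mul, sum_residual_mul]
  simp only [mul_comm]

lemma gammaAB_eq (n : ℕ) (x : Fin a → Fin b → ℝ) :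
    gammaAB n x = n * ∑ i, ∑ j, residual x i j ^ 2 := rfl

lemma ssAB_eq_gammaAB_cellMean (y : Fin a → Fin b → Fin n → ℝ) :
    ssAB y = gammaAB n fun i j => (∑ k, y i j k) / n := by
  simp only [ssAB, gammaAB, rowMean, colMean, grandMean, ← Finset.sum_div, div_div,
    Finset.sum_const, Finset.card_univ, Fintype.card_fin, nsmul_eq_mul, ← Finset.mul_sum]
  simp only [mul_comm (n : ℝ)]

/-- The interaction sum of squares depends only on the interaction effects and the cell means of
the errors. -/
lemma ssAB_response (ha : a ≠ 0) (hb : b ≠ 0) (hn : n ≠ 0) (mu : ℝ) (α : Fin a → ℝ)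
    (β : Fin b → ℝ) (ab : Fin a → Fin b → ℝ) (e : Fin a → Fin b → Fin n → ℝ) :
    ssAB (response mu α β ab e) = gammaAB n fun i j => ab i j + (∑ k, e i j k) / n := by
  have hn' : (n : ℝ) ≠ 0 := by exact_mod_cast hn
  have hmean : (fun i j => (∑ k, response mu α β ab e i j k) / n) =
      fun i j => ((mu + α i) + β j) + (ab i j + (∑ k, e i j k) / n) := by
    ext i j
    simp only [response, Finset.sum_add_distrib, Finset.sum_const, Finset.card_univ,
      Fintype.card_fin, nsmul_eq_mul]
    field_simp
    ring
  rw [ssAB_eq_gammaAB_cellMean, hmean, gammaAB_eq, gammaAB_eq]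
  refine congrArg _ (Finset.sum_congr rfl fun i _ => Finset.sum_congr rfl fun j _ => ?_)
  rw [residual_add (fun i j => (mu + α i) + β j),
    residual_additive ha hb (fun i => mu + α i) β, zero_add]

/-- The map taking a two-way table to its interaction residuals. -/
noncomputable def residualMap (a b : ℕ) :
    EuclideanSpace ℝ (Fin a × Fin b) →ₗ[ℝ] EuclideanSpace ℝ (Fin a × Fin b) where
  toFun x := WithLp.toLp 2 fun p => residual (fun i j => x (i, j)) p.1 p.2
  map_add' x y := by
    ext p
    exact residual_add (fun i j => x (i, j)) (fun i j => y (i, j)) p.1 p.2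
  map_smul' c x := by
    ext p
    exact residual_const_mul c (fun i j => x (i, j)) p.1 p.2

lemma residualMap_apply (x : EuclideanSpace ℝ (Fin a × Fin b)) (p : Fin a × Fin b) :
    residualMap a b x p = residual (fun i j => x (i, j)) p.1 p.2 := rfl

lemma residualMap_idem (ha : a ≠ 0) (hb : b ≠ 0) (x : EuclideanSpace ℝ (Fin a × Fin b)) :
    residualMap a b (residualMap a b x) = residualMap a b x := by
  ext p
  exact residual_idem ha hb (fun i j => x (i, j)) p.1 p.2

lemma inner_residualMap_left (x y : EuclideanSpace ℝ (Fin a × Fin b)) :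
    inner ℝ (residualMap a b x) y = inner ℝ x (residualMap a b y) := by
  simp only [PiLp.inner_apply, RCLike.inner_apply, conj_trivial, residualMap_apply,
    Fintype.sum_prod_type]
  simpa only [mul_comm] using
    sum_residual_mul_comm (fun i j => x (i, j)) (fun i j => y (i, j))

lemma norm_residualMap_sq (x : EuclideanSpace ℝ (Fin a × Fin b)) :
    ‖residualMap a b x‖ ^ 2 = ∑ i, ∑ j, residual (fun i j => x (i, j)) i j ^ 2 := by
  simp [EuclideanSpace.norm_sq_eq, residualMap_apply, Fintype.sum_prod_type]

/-- All `ab` diagonal entries equal `(1 - 1/a)(1 - 1/b)`. -/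
lemma trace_residualMap (ha : a ≠ 0) (hb : b ≠ 0) :
    LinearMap.trace ℝ _ (residualMap a b) = ((a - 1) * (b - 1) : ℕ) := by
  have ha' : (a : ℝ) ≠ 0 := by exact_mod_cast ha
  have hb' : (b : ℝ) ≠ 0 := by exact_mod_cast hb
  rw [LinearMap.trace_eq_sum_inner _ (EuclideanSpace.basisFun (Fin a × Fin b) ℝ)]
  have h (p : Fin a × Fin b) : inner ℝ (EuclideanSpace.basisFun (Fin a × Fin b) ℝ p)
      (residualMap a b (EuclideanSpace.basisFun (Fin a × Fin b) ℝ p)) =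
      1 - 1 / b - 1 / a + 1 / (a * b) := by
    obtain ⟨i, j⟩ := p
    rw [EuclideanSpace.basisFun_inner, residualMap_apply]
    simp [residual, rowMean, colMean, grandMean, EuclideanSpace.basisFun_apply,
      ite_and]
  simp only [h, Finset.sum_const, Finset.card_univ, Fintype.card_prod, Fintype.card_fin,
    nsmul_eq_mul]
  push_cast [Nat.one_le_iff_ne_zero.2 ha, Nat.one_le_iff_ne_zero.2 hb]
  field_simp
  ring

lemma finrank_range_residualMap (ha : a ≠ 0) (hb : b ≠ 0) :
    Module.finrank ℝ (residualMap a b).range = (a - 1) * (b - 1) := by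
  have hproj : LinearMap.IsProj (residualMap a b).range (residualMap a b) := by
    refine ⟨fun x => ⟨x, rfl⟩, ?_⟩
    rintro _ ⟨x, rfl⟩
    exact residualMap_idem ha hb x
  have h := hproj.trace
  rw [trace_residualMap ha hb] at h
  exact_mod_cast h.symm

end Residual

/-- An orthonormal basis in which a given vector has at most its first coordinate nonzero. -/
lemma exists_orthonormalBasis_inner_eq {V : Type*} [NormedAddCommGroup V] [InnerProductSpace ℝ V]
    [FiniteDimensional ℝ V] {p : ℕ} (hp : Module.finrank ℝ V = p) (m : V) :
    ∃ B : OrthonormalBasis (Fin p) ℝ V, ∀ i : Fin p,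
      inner ℝ (B i) m = if (i : ℕ) = 0 then ‖m‖ else 0 := by
  by_cases hm : m = 0
  · exact ⟨(stdOrthonormalBasis ℝ V).reindex (finCongr hp), fun i => by simp [hm]⟩
  have hm' : ‖m‖ ≠ 0 := norm_ne_zero_iff.2 hm
  -- The index set has at most one element, and is empty for `p = 0`, so that case needs no separate
  -- treatment.
  have hv : Orthonormal ℝ (({i : Fin p | (i : ℕ) = 0} : Set (Fin p)).domRestrict
      fun _ => ‖m‖⁻¹ • m) := by
    refine ⟨fun i => by simp [norm_smul, hm'], fun i j hij => ?_⟩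
    exact absurd (Subtype.ext (Fin.ext (i.2.trans j.2.symm))) hij
  obtain ⟨B, hB⟩ := hv.exists_orthonormalBasis_extension_of_card_eq (by simpa using hp)
  refine ⟨B, fun i => ?_⟩
  have hp0 : 0 < p := i.pos
  have h0 : B ⟨0, hp0⟩ = ‖m‖⁻¹ • m := hB _ rfl
  have hm0 : m = ‖m‖ • B ⟨0, hp0⟩ := by rw [h0, smul_smul, mul_inv_cancel₀ hm', one_smul]
  rw [hm0, inner_smul_right, orthonormal_iff_ite.1 B.orthonormal, norm_smul, B.norm_eq_one]
  simp [Fin.ext_iff]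

/-! ### Laws of projected Gaussian tables -/

section Gaussian

variable {Ω : Type*} [MeasurableSpace Ω] {P : Measure Ω}

/-- Uncorrelated linear combinations of independent centred normal variables, all with the same
variance, are independent and normal. -/
lemma hasLaw_pi_gaussianReal_sum_mul [IsProbabilityMeasure P] {ι σ : Type*} [Fintype ι]
    [DecidableEq ι] [Fintype σ] {Y : σ → Ω → ℝ} {w : σ → ℝ≥0} {v : ℝ≥0} (c : ι → σ → ℝ)
    (hY : ∀ s, HasLaw (Y s) (gaussianReal 0 (w s)) P) (hindep : iIndepFun Y P)
    (hc : ∀ p q, ∑ s, c p s * c q s * w s = if p = q then (v : ℝ) else 0) :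
    HasLaw (fun ω p => ∑ s, c p s * Y s ω) (Measure.pi fun _ : ι => gaussianReal 0 v) P := by
  classical
  have hYG (s) : HasGaussianLaw (Y s) P := (hY s).hasGaussianLaw
  have hjoint : HasGaussianLaw (fun ω => (fun p => ∑ s, c p s * Y s ω : ι → ℝ)) P := by
    have h := (hindep.hasGaussianLaw hYG).map_fun
      (Matrix.mulVecLin (Matrix.of c)).toContinuousLinearMap
    exact h
  have hcovY (s t : σ) : cov[Y s, Y t; P] = if s = t then (w s : ℝ) else 0 := by
    split_ifs with h
    · subst h
      rw [covariance_self (hY s).aemeasurable, (hY s).variance_eq, variance_id_gaussianReal]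
    · exact (hindep.indepFun h).covariance_eq_zero (hYG s).memLp_two (hYG t).memLp_two
  have hcov (p q : ι) : cov[fun ω => ∑ s, c p s * Y s ω, fun ω => ∑ s, c q s * Y s ω; P] =
      if p = q then (v : ℝ) else 0 := by
    rw [covariance_fun_sum_fun_sum (fun s => (hYG s).memLp_two.const_mul _)
      (fun s => (hYG s).memLp_two.const_mul _), ← hc]
    refine Finset.sum_congr rfl fun s _ => ?_
    simp only [covariance_const_mul_left, covariance_const_mul_right, hcovY]
    simp [mul_assoc, mul_left_comm]
  -- Joint normality upgrades vanishing covariances to independence.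
  have hind : iIndepFun (fun p ω => ∑ s, c p s * Y s ω) P :=
    hjoint.iIndepFun_of_covariance_eq_zero fun p q hpq => by rw [hcov, if_neg hpq]
  refine hind.hasLaw_pi fun p => ⟨(hjoint.eval p).aemeasurable, ?_⟩
  have hmean : ∫ ω, ∑ s, c p s * Y s ω ∂P = 0 := by
    rw [integral_finsetSum _ fun s _ => (hYG s).integrable.const_mul _]
    refine Finset.sum_eq_zero fun s _ => ?_
    rw [integral_const_mul, (hY s).integral_eq, integral_id_gaussianReal, mul_zero]
  rw [(hjoint.eval p).map_eq_gaussianReal, hmean,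
    ← covariance_self (hjoint.eval p).aemeasurable, hcov, if_pos rfl, Real.toNNReal_coe]

lemma pi_gaussianReal_eq_map {ι : Type*} [Fintype ι] (v : ℝ≥0) :
    Measure.pi (fun _ : ι => gaussianReal 0 v) =
      (Measure.pi fun _ : ι => gaussianReal 0 1).map fun z i => √v * z i := by
  have h : gaussianReal 0 v = (gaussianReal 0 1).map (√v * ·) := by
    rw [gaussianReal_map_const_mul]
    congr 1
    · simp
    · ext; simp
  have : SigmaFinite ((gaussianReal 0 1).map (√v * ·)) := by rw [← h]; infer_instance
  rw [Measure.pi_map_pi (f := fun _ x => √v * x) fun _ => by fun_prop, ← h]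

lemma noncentralChiSq_zero (p : ℕ) : noncentralChiSq p 0 = chiSq p := by
  simp [noncentralChiSq, chiSq]

variable {a b n : ℕ}

/-- The law of `γ_AB` for a table of independent normal variables of equal variance `v` and means
`m`. -/
lemma hasLaw_gammaAB [IsProbabilityMeasure P] (ha : a ≠ 0) (hb : b ≠ 0) (hn : n ≠ 0) {v : ℝ≥0}
    {W : Ω → Fin a × Fin b → ℝ}
    (hW : HasLaw W (Measure.pi fun _ => gaussianReal 0 v) P) (m : Fin a → Fin b → ℝ) {lam : ℝ}
    (hm : gammaAB n m = n * v * lam) :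
    HasLaw (fun ω => gammaAB n fun i j => m i j + W ω (i, j))
      (scaleLaw (n * v) (noncentralChiSq ((a - 1) * (b - 1)) lam)) P := by
  have hn' : (n : ℝ) ≠ 0 := by exact_mod_cast hn
  let m' : EuclideanSpace ℝ (Fin a × Fin b) := WithLp.toLp 2 fun p => m p.1 p.2
  let T := residualMap a b
  obtain ⟨B, hB⟩ := exists_orthonormalBasis_inner_eq (finrank_range_residualMap ha hb)
    (⟨T m', m', rfl⟩ : T.range)
  -- Since `T` fixes its range and is self-adjoint, `⟨B i, T x⟩ = ⟨B i, x⟩`.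
  have hTB (i) : T (B i) = B i := by
    obtain ⟨x, hx⟩ := (B i).2
    rw [← hx]
    exact residualMap_idem ha hb x
  have hnorm (x : EuclideanSpace ℝ (Fin a × Fin b)) :
      ‖T x‖ ^ 2 = ∑ i, inner ℝ (B i : EuclideanSpace ℝ (Fin a × Fin b)) x ^ 2 := by
    have h := B.sum_sq_norm_inner_right (⟨T x, x, rfl⟩ : T.range)
    rw [Submodule.coe_norm] at h
    rw [← h]
    refine Finset.sum_congr rfl fun i _ => ?_
    rw [Submodule.coe_inner, Real.norm_eq_abs, sq_abs, ← inner_residualMap_left]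
    exact congrArg (fun y => inner ℝ y x ^ 2) (hTB i)
  have hinner (i) : inner ℝ (B i : EuclideanSpace ℝ (Fin a × Fin b)) m' =
      √v * if (i : ℕ) = 0 then √lam else 0 := by
    have h := hB i
    rw [Submodule.coe_inner, Submodule.coe_norm, ← inner_residualMap_left] at h
    have hTm : ‖T m'‖ = √v * √lam := by
      rw [← Real.sqrt_mul v.coe_nonneg, ← Real.sqrt_sq (norm_nonneg (T m')), norm_residualMap_sq]
      congr 1
      rw [gammaAB_eq, mul_assoc] at hm
      exact mul_left_cancel₀ hn' hm
    rw [mul_ite, mul_zero, ← hTm, ← h]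
    exact congrArg (fun y => inner ℝ y m') (hTB i).symm
  have hG : HasLaw (fun ω i => ∑ s, (B i : EuclideanSpace ℝ (Fin a × Fin b)) s * W ω s)
      (Measure.pi fun _ : Fin ((a - 1) * (b - 1)) => gaussianReal 0 v) P := by
    have hWs (s) : HasLaw (fun ω => W ω s) (gaussianReal 0 v) P :=
      (measurePreserving_eval (fun _ => gaussianReal 0 v) s).hasLaw.comp hW
    refine hasLaw_pi_gaussianReal_sum_mul (Y := fun s ω => W ω s) (w := fun _ => v) _ hWs
      ((iIndepFun_iff_hasLaw_pi_pi hWs).2 hW) fun i j => ?_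
    have h := orthonormal_iff_ite.1 B.orthonormal i j
    rw [Submodule.coe_inner] at h
    simp only [PiLp.inner_apply, RCLike.inner_apply, conj_trivial] at h
    rw [← Finset.sum_mul]
    simp only [mul_comm ((B i : EuclideanSpace ℝ (Fin a × Fin b)) _)]
    rw [h]
    simp
  have hgamma (ω) : gammaAB n (fun i j => m i j + W ω (i, j)) =
      n * ∑ i : Fin ((a - 1) * (b - 1)),
        (∑ s, (B i : EuclideanSpace ℝ (Fin a × Fin b)) s * W ω s
          + √v * if (i : ℕ) = 0 then √lam else 0) ^ 2 := by
    rw [gammaAB_eq]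
    have h := hnorm (m' + WithLp.toLp 2 (W ω))
    rw [norm_residualMap_sq] at h
    refine congrArg _ (h.trans (Finset.sum_congr rfl fun i _ => ?_))
    rw [inner_add_right, hinner, add_comm]
    simp [PiLp.inner_apply, mul_comm]
  simp only [hgamma]
  refine HasLaw.comp (Y := fun g : Fin ((a - 1) * (b - 1)) → ℝ => (n : ℝ) * ∑ i,
    (g i + √v * if (i : ℕ) = 0 then √lam else 0) ^ 2) ⟨Measurable.aemeasurable (by fun_prop), ?_⟩ hG
  rw [pi_gaussianReal_eq_map, scaleLaw, noncentralChiSq, Measure.map_map (by fun_prop)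
    (by fun_prop), Measure.map_map (by fun_prop) (by fun_prop)]
  congr 1
  ext z
  simp only [Function.comp, ← mul_add, mul_pow, ← Finset.mul_sum]
  rw [Real.sq_sqrt v.coe_nonneg, mul_assoc]

end Gaussian

end TwoWay

theorem mainTheorem4 {Ω : Type*} [MeasurableSpace Ω] (P : Measure Ω) [IsProbabilityMeasure P]
    (a b n : ℕ) (ha : 1 ≤ a) (hb : 1 ≤ b) (hn : 1 ≤ n)
    -- the variance components `σ²` (errors) and `σ²_{αβ}` (interaction)
    (vE vAB : ℝ≥0) (hvE : 0 < vE)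
    -- the overall mean, and the main effects: constants, or random with any joint law
    (mu : ℝ) (α : Fin a → Ω → ℝ) (β : Fin b → Ω → ℝ)
    -- the random interaction effects and the errors
    (ab : Fin a → Fin b → Ω → ℝ) (e : Fin a → Fin b → Fin n → Ω → ℝ)
    (hab : ∀ i j, HasLaw (ab i j) (gaussianReal 0 vAB) P)
    (he : ∀ i j k, HasLaw (e i j k) (gaussianReal 0 vE) P)
    -- all interaction effects and all errors are mutually independent
    (hindep : iIndepFun
      (Sum.elim (fun p : Fin a × Fin b => ab p.1 p.2)
        (fun q : Fin a × Fin b × Fin n => e q.1 q.2.1 q.2.2)) P) :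
    -- for fixed effects, `γ_AB / σ²` is the noncentrality parameter of `SS_AB / σ²`
    (∀ (α₀ : Fin a → ℝ) (β₀ : Fin b → ℝ) (ab₀ : Fin a → Fin b → ℝ),
      HasLaw (fun ω => TwoWay.ssAB (TwoWay.response mu α₀ β₀ ab₀ fun i j k => e i j k ω))
        (TwoWay.scaleLaw vE
          (TwoWay.noncentralChiSq ((a - 1) * (b - 1)) (TwoWay.gammaAB n ab₀ / vE))) P) ∧
    -- the law of `γ_AB` for random interaction effects
    HasLaw (fun ω => TwoWay.gammaAB n fun i j => ab i j ω)
      (TwoWay.scaleLaw (n * vAB) (TwoWay.chiSq ((a - 1) * (b - 1)))) P ∧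
    -- the law of `SS_AB` for random interaction effects
    HasLaw (fun ω => TwoWay.ssAB
        (TwoWay.response mu (fun i => α i ω) (fun j => β j ω) (fun i j => ab i j ω)
          fun i j k => e i j k ω))
      (TwoWay.scaleLaw (vE + n * vAB) (TwoWay.chiSq ((a - 1) * (b - 1)))) P := by
  have ha' : a ≠ 0 := by omega
  have hb' : b ≠ 0 := by omega
  have hn' : n ≠ 0 := by omega
  have hnR : (n : ℝ) ≠ 0 := by exact_mod_cast hn'
  have hvE' : (vE : ℝ) ≠ 0 := by exact_mod_cast hvE.ne'
  have hγ0 : TwoWay.gammaAB n (fun (_ : Fin a) (_ : Fin b) => (0 : ℝ)) = 0 := by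
    simp [TwoWay.gammaAB, TwoWay.rowMean, TwoWay.colMean, TwoWay.grandMean]
  -- The joint law of the variables `d (αβ)_{ij} + ē_{ij.}`, for a constant `d`.
  have hcell (d : ℝ≥0) : HasLaw (fun ω (p : Fin a × Fin b) =>
      d * ab p.1 p.2 ω + (∑ k, e p.1 p.2 k ω) / n)
      (Measure.pi fun _ => gaussianReal 0 (d ^ 2 * vAB + vE / n)) P := by
    -- Weight `d` on the cell's interaction and `1 / n` on its `n` errors. Distinct cells use
    -- disjoint variables; within a cell the variance is `d² vAB + n (1/n)² vE`.
    have h := TwoWay.hasLaw_pi_gaussianReal_sum_mul (w := Sum.elim (fun _ => vAB) fun _ => vE)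
      (v := d ^ 2 * vAB + vE / n)
      (fun p : Fin a × Fin b => Sum.elim (fun q : Fin a × Fin b => if q = p then (d : ℝ) else 0)
        fun q : Fin a × Fin b × Fin n => if q.1 = p.1 then if q.2.1 = p.2 then (1 / n : ℝ) else 0
          else 0)
      (by rintro (p | q); exacts [hab _ _, he _ _ _]) hindep ?_
    · convert h using 3 with ω p
      simp [Fintype.sum_sum_type, Fintype.sum_prod_type, div_eq_inv_mul, Finset.mul_sum]
    · rintro ⟨i, j⟩ ⟨i', j'⟩
      by_cases hi : i = i' <;> by_cases hj : j = j' <;>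
        simp [Fintype.sum_sum_type, Fintype.sum_prod_type, @eq_comm _ i' i,
          @eq_comm _ j' j, hi, hj]
      field_simp
  refine ⟨fun α₀ β₀ ab₀ => ?_, ?_, ?_⟩
  -- `d = 0` removes the random interactions; the fixed ones enter as the mean table.
  · have h := TwoWay.hasLaw_gammaAB ha' hb' hn' (hcell 0) ab₀
      (lam := TwoWay.gammaAB n ab₀ / vE) (by push_cast; field_simp; ring)
    simp only [TwoWay.ssAB_response ha' hb' hn']
    convert h using 3
    · simp
    · push_cast; field_simp; ring
  · have hW : HasLaw (fun ω (p : Fin a × Fin b) => ab p.1 p.2 ω)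
        (Measure.pi fun _ => gaussianReal 0 vAB) P :=
      (hindep.precomp Sum.inl_injective).hasLaw_pi fun p => hab p.1 p.2
    -- `vAB` may vanish here, which is harmless because the noncentrality condition is a product,
    -- not a quotient.
    have h := TwoWay.hasLaw_gammaAB ha' hb' hn' hW (fun _ _ => 0) (lam := 0) (by simp [hγ0])
    simpa only [zero_add, TwoWay.noncentralChiSq_zero] using h
  -- With `d = 1` the scale is `n (vAB + vE / n) = vE + n vAB`.
  · have h := TwoWay.hasLaw_gammaAB ha' hb' hn' (hcell 1) (fun _ _ => 0) (lam := 0)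
      (by simp [hγ0])
    simp only [TwoWay.ssAB_response ha' hb' hn']
    rw [TwoWay.noncentralChiSq_zero] at h
    convert h using 3
    · simp
    · push_cast; field_simp; ring
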